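/- Let $G$ be a simple complex algebraic group (that is, a connected, non-commutative linear algebraic group over $\mathbb{C}$ without connected closed normal subgroups other than $1$ and $G$), realised as a Zariski closed subgroup of some $\mathrm{GL}_n(\mathbb{C})$, and let $\mathfrak{g}$ be its Lie algebra. For $g\in G$ let $\overline{\langle g\rangle}$ be the smallest Zariski closed subgroup of $G$ containing $g$. For $g\in G$ and $Y\in\mathfrak{g}$ let $g_s$ and $Y_s$ be the semisimple parts in the (multiplicative, respectively additive) Jordan decomposition. For a semisimple element $s\in G$ and a maximal torus $T'\subseteq G$ containing $s$, with character lattice $X^*(T')$, put $$X^*(s):=\{\lambda(s)\mid \lambda\in X^*(T')\}\subset\mathbb{C}^\times,$$ a subgroup of $\mathbb{C}^\times$. For a semisimple element $S\in\mathfrak{g}$ and a maximal torus $T'\subseteq G$ whose Lie algebra contains $S$, put $$X^*(S):=\{d\lambda(S)\mid \lambda\in X^*(T')\}\subset\mathbb{C}.$$ These sets do not depend on the choice of $T'$; the statements below hold for every choice of $T'$. (1) If $g\in G$, then $\overline{\langle g\rangle}$ is connected if and only if $X^*(g_s)$ is torsion-free. (2) If $Y\in\mathfrak{g}$, then $\overline{\langle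 \exp(2\pi i Y)\rangle}$ is connected if and only if $X^*(Y_s)\cap(\mathbb{Q}\setminus\mathbb{Z})=\varnothing$. -/

import Mathlib

open scoped MatrixGroups Topology

noncomputable section

namespace LinAlgGrp

/-! ### Zariski topology on `GL_n(ℂ)` -/

/-- The value at an invertible matrix `g` of a polynomial in the `n²` matrix entries. -/
def evalAt {n : ℕ} (g : GL (Fin n) ℂ) (p : MvPolynomial (Fin n × Fin n) ℂ) : ℂ :=
  MvPolynomial.eval (fun ij => (g : Matrix (Fin n) (Fin n) ℂ) ij.1 ij.2) p

/-- The common zeros in `GL_n(ℂ)` of a set of polynomials in the matrix entries. -/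
def zeroSet {n : ℕ} (S : Set (MvPolynomial (Fin n × Fin n) ℂ)) : Set (GL (Fin n) ℂ) :=
  {g | ∀ p ∈ S, evalAt g p = 0}

/-- The Zariski topology on `GL_n(ℂ)`: the closed sets are the zero sets of polynomials.
(Denominators `det ^ k` give no further closed sets.) -/
@[reducible] def zariskiTopology (n : ℕ) : TopologicalSpace (GL (Fin n) ℂ) :=
  TopologicalSpace.ofClosed (Set.range (zeroSet (n := n)))
    ⟨{1}, by
      ext g
      simp [zeroSet, evalAt]⟩
    (by
      intro A hA
      refine ⟨{p | ∃ S, zeroSet S ∈ A ∧ p ∈ S}, ?_⟩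
      ext g
      simp only [zeroSet, Set.mem_ofPred_eq, Set.mem_sInter]
      constructor
      · intro h Z hZ
        obtain ⟨S, rfl⟩ := hA hZ
        exact fun p hp => h p ⟨S, hZ, hp⟩
      · rintro h p ⟨S, hS, hp⟩
        exact h _ hS p hp)
    (by
      rintro _ ⟨S, rfl⟩ _ ⟨S', rfl⟩
      refine ⟨{r | ∃ p ∈ S, ∃ q ∈ S', r = p * q}, ?_⟩
      ext g
      simp only [zeroSet, Set.mem_ofPred_eq, Set.mem_union]
      constructor
      · intro h
        by_contra! hc
        obtain ⟨⟨p, hp, hp0⟩, q, hq, hq0⟩ := hc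
        have := h (p * q) ⟨p, hp, q, hq, rfl⟩
        rw [evalAt, map_mul, mul_eq_zero] at this
        exact this.elim hp0 hq0
      · rintro (h | h) r ⟨p, hp, q, hq, rfl⟩
        · have := h p hp
          rw [evalAt] at this ⊢
          rw [map_mul, this, zero_mul]
        · have := h q hq
          rw [evalAt] at this ⊢
          rw [map_mul, this, mul_zero])

/-- `H` is Zariski closed in `GL_n(ℂ)`. -/
def IsZariskiClosed {n : ℕ} (H : Subgroup (GL (Fin n) ℂ)) : Prop :=
  IsClosed[zariskiTopology n] (H : Set (GL (Fin n) ℂ))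

/-- `H` is connected in the Zariski topology. -/
def IsZariskiConnected {n : ℕ} (H : Subgroup (GL (Fin n) ℂ)) : Prop :=
  @IsConnected (GL (Fin n) ℂ) (zariskiTopology n) (H : Set (GL (Fin n) ℂ))

/-- The smallest Zariski closed subgroup of `G` containing `g`. -/
def closedHull {n : ℕ} (G : Subgroup (GL (Fin n) ℂ)) (g : GL (Fin n) ℂ) :
    Subgroup (GL (Fin n) ℂ) :=
  sInf {H | H ≤ G ∧ IsZariskiClosed H ∧ g ∈ H}

/-- `G ⊆ GL_n(ℂ)` is a simple linear algebraic group: Zariski closed, connected, not commutative,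
and its only connected closed normal subgroups are the trivial one and `G` itself. -/
structure IsSimpleAlgebraicGroup {n : ℕ} (G : Subgroup (GL (Fin n) ℂ)) : Prop where
  closed : IsZariskiClosed G
  connected : IsZariskiConnected G
  not_comm : ∃ g ∈ G, ∃ h ∈ G, g * h ≠ h * g
  simple : ∀ N : Subgroup (GL (Fin n) ℂ), N ≤ G → IsZariskiClosed N → IsZariskiConnected N →
    (∀ g ∈ G, ∀ x ∈ N, g * x * g⁻¹ ∈ N) → N = ⊥ ∨ N = G

/-! ### Regular functions, characters and tori -/

/-- `f` is a regular function on the closed subgroup `H` of `GL_n(ℂ)`: the restriction of a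
polynomial in the matrix entries divided by a power of the determinant. -/
def IsRegular {n : ℕ} (H : Subgroup (GL (Fin n) ℂ)) (f : H → ℂ) : Prop :=
  ∃ (p : MvPolynomial (Fin n × Fin n) ℂ) (k : ℕ), ∀ h : H,
    f h = evalAt (h : GL (Fin n) ℂ) p /
      ((h : GL (Fin n) ℂ) : Matrix (Fin n) (Fin n) ℂ).det ^ k

/-- `f` is a regular function on `(ℂˣ)^r`, that is, a Laurent polynomial in the coordinates. -/
def IsRegularOnGm {r : ℕ} (f : (Fin r → ℂˣ) → ℂ) : Prop :=
  ∃ (p : MvPolynomial (Fin r) ℂ) (k : ℕ), ∀ z : Fin r → ℂˣ,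
    f z = MvPolynomial.eval (fun i => (z i : ℂ)) p / (∏ i, (z i : ℂ)) ^ k

/-- `T ⊆ GL_n(ℂ)` is a torus: a closed subgroup isomorphic, as an algebraic group, to `(ℂˣ)^r`. -/
def IsTorus {n : ℕ} (T : Subgroup (GL (Fin n) ℂ)) : Prop :=
  IsZariskiClosed T ∧ ∃ (r : ℕ) (e : T ≃* (Fin r → ℂˣ)),
    (∀ i, IsRegular T (fun t => (e t i : ℂ))) ∧
    (∀ i j, IsRegularOnGm
      (fun z => ((e.symm z : GL (Fin n) ℂ) : Matrix (Fin n) (Fin n) ℂ) i j))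

/-- `T` is a maximal torus of `G`. -/
def IsMaximalTorus {n : ℕ} (G T : Subgroup (GL (Fin n) ℂ)) : Prop :=
  Maximal (fun S : Subgroup (GL (Fin n) ℂ) => IsTorus S ∧ S ≤ G) T

/-- The character lattice `X^*(T)`: all homomorphisms of algebraic groups `T → ℂˣ`, that is, the
homomorphisms for which both `λ` and `λ⁻¹` are regular functions, as for any morphism to `ℂˣ`. -/
def characterLattice {n : ℕ} (T : Subgroup (GL (Fin n) ℂ)) : Subgroup (T →* ℂˣ) where
  carrier := {χ | IsRegular T (fun t => (χ t : ℂ)) ∧ IsRegular T (fun t => ((χ t)⁻¹ : ℂˣ))}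
  one_mem' := by
    refine ⟨⟨1, 0, fun h => ?_⟩, ⟨1, 0, fun h => ?_⟩⟩ <;> simp [evalAt]
  mul_mem' := by
    rintro χ ψ ⟨⟨p, k, hp⟩, ⟨p', k', hp'⟩⟩ ⟨⟨q, l, hq⟩, ⟨q', l', hq'⟩⟩
    refine ⟨⟨p * q, k + l, fun h => ?_⟩, ⟨p' * q', k' + l', fun h => ?_⟩⟩
    · have h1 := hp h
      have h2 := hq h
      simp only [evalAt] at h1 h2 ⊢
      rw [MonoidHom.mul_apply, Units.val_mul, h1, h2, map_mul, pow_add, div_mul_div_comm]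
    · have h1 := hp' h
      have h2 := hq' h
      simp only [evalAt] at h1 h2 ⊢
      rw [MonoidHom.mul_apply, mul_inv, Units.val_mul, h1, h2, map_mul, pow_add,
        div_mul_div_comm]
  inv_mem' := by
    rintro χ ⟨h, h'⟩
    refine ⟨h', ?_⟩
    simpa using h

/-- `X^*(s) = {λ(s) | λ ∈ X^*(T)}`, a subgroup of `ℂˣ`, for an element `s` of a torus `T`. -/
def characterValues {n : ℕ} (T : Subgroup (GL (Fin n) ℂ)) (s : T) : Subgroup ℂˣ :=
  (characterLattice T).map (MonoidHom.eval s)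

/-! ### Exponential and Lie algebras -/

/-- The matrix exponential, with values in `GL_n(ℂ)`. -/
def expGL {n : ℕ} (Y : Matrix (Fin n) (Fin n) ℂ) : GL (Fin n) ℂ :=
  (Matrix.isUnit_exp Y).unit

/-- The underlying set of the Lie algebra of a closed subgroup `H` of `GL_n(ℂ)`: the matrices that
generate a complex one-parameter subgroup of `H`. -/
def lieAlgebra {n : ℕ} (H : Subgroup (GL (Fin n) ℂ)) : Set (Matrix (Fin n) (Fin n) ℂ) :=
  {Y | ∀ t : ℂ, expGL (t • Y) ∈ H}

/-- `X^*(Y) = {dλ(Y) | λ ∈ X^*(T)}` for `Y` in the Lie algebra of a torus `T`, where `dλ(Y)` is the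
derivative at `t = 0` of `λ(exp(tY))`. -/
def characterDifferentials {n : ℕ} (T : Subgroup (GL (Fin n) ℂ))
    (Y : Matrix (Fin n) (Fin n) ℂ) (hY : Y ∈ lieAlgebra T) : Set ℂ :=
  {c | ∃ χ ∈ characterLattice T,
    HasDerivAt (fun t : ℂ => (χ (⟨expGL (t • Y), hY t⟩ : T) : ℂ)) c 0}

/-! ### Jordan decompositions -/

/-- A complex matrix is semisimple (equivalently, diagonalisable). -/
def IsSemisimpleMatrix {n : ℕ} (A : Matrix (Fin n) (Fin n) ℂ) : Prop :=
  Module.End.IsSemisimple (Matrix.toLin' A)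

/-- `s` is the semisimple part of `g` in the multiplicative Jordan decomposition `g = s u = u s`
with `s` semisimple and `u` unipotent. -/
def IsSemisimplePartOf {n : ℕ} (s g : GL (Fin n) ℂ) : Prop :=
  ∃ u : GL (Fin n) ℂ, g = s * u ∧ g = u * s ∧
    IsSemisimpleMatrix (s : Matrix (Fin n) (Fin n) ℂ) ∧
    IsNilpotent ((u : Matrix (Fin n) (Fin n) ℂ) - 1)

/-- `S` is the semisimple part of `Y` in the additive Jordan decomposition `Y = S + N`
with `S` semisimple, `N` nilpotent and `S N = N S`. -/
def IsLieSemisimplePartOf {n : ℕ} (S Y : Matrix (Fin n) (Fin n) ℂ) : Prop :=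
  ∃ N : Matrix (Fin n) (Fin n) ℂ, Y = S + N ∧ Commute S N ∧
    IsSemisimpleMatrix S ∧ IsNilpotent N

end LinAlgGrp

end

/-!
# Connectedness of the closed subgroup generated by one element

Write `g = s u = u s` with `s` semisimple, lying in a torus `T ⊆ G`, and `u` unipotent, and let `A`
be the Zariski closure of the cyclic group `{g ^ k | k ∈ ℤ}`. As the powers of `g` are Zariski
dense in `A`, everything is decided by the sequences `k ↦ p (g ^ k)` for polynomials `p` in the
matrix entries.

*Torsion-free implies connected.* The entries of `s ^ k` are Laurent polynomials in the values at
`s` of the coordinate characters of `T`, raised to the power `k`, and the entries of `u ^ k` are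
polynomials in `k`. So `p (g ^ k)` is an exponential polynomial `∑ c_μ(k) μ ^ k`, with `μ` in a
finitely generated subgroup `M` of `X^*(s)`. Exponential polynomials form the group algebra
`ℂ[X][M]`, because the sequences belonging to different `μ` lie in independent generalised
eigenspaces of the shift (`eq_zero_of_evalExpPoly`). When `M` is torsion-free this group algebra is
a domain, so the ideal of polynomials vanishing on the powers of `g` is prime, and `A` is
irreducible (`isZariskiConnected_of_isMulTorsionFree`).

*Connected implies torsion-free.* A semisimple matrix that is nilpotent is zero; this yields a
linear map `π` on matrices with `π (g ^ k) = s ^ k` for all `k` (`exists_linearMap_zpow_eq`). If a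
character `χ` takes a value `ζ` with `ζ ^ m = 1` at `s`, then composing a polynomial for `χ` with
`π` gives `q` such that `q = ζ ^ k det ^ K` at `g ^ k`. The closed conditions `q = det ^ K` and
`∑ q ^ i det ^ (K (m - 1 - i)) = 0` then cut `A` into two disjoint pieces, of which the first contains
`1`; connectedness forces `g` into it, that is, `ζ = 1` (`eq_one_of_isZariskiConnected`).

*Lie algebra version.* The semisimple part of `exp (2πi Y)` is `exp (2πi Y_s)`, and a character
takes there the value `exp (2πi dχ(Y_s))` (`character_expGL_eq_exp`). This is a nontrivial root of
unity exactly when `dχ(Y_s)` is rational but not an integer.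
-/

noncomputable section

namespace LinAlgGrp

/-! ### Exponential polynomials and powers of a unipotent matrix -/

section ExponentialPolynomials

open Polynomial

/-- The shift operator on sequences indexed by `ℤ`. -/
def shift : Module.End ℂ (ℤ → ℂ) where
  toFun f k := f (k + 1)
  map_add' _ _ := rfl
  map_smul' _ _ := rfl

/-- `shift - μ` replaces `c` by `μ (c(X + 1) - c)`, which has smaller degree, so iterating it kills
`k ↦ c(k) μ ^ k`. -/
theorem mem_maxGenEigenspace_shift (μ : ℂˣ) (c : ℂ[X]) :
    (fun k : ℤ => c.eval (k : ℂ) * ((μ ^ k : ℂˣ) : ℂ)) ∈ shift.maxGenEigenspace (μ : ℂ) := by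
  rw [Module.End.mem_maxGenEigenspace]
  induction hd : c.natDegree using Nat.strong_induction_on generalizing c with
  | _ d ih =>
  have key : (shift - (μ : ℂ) • 1) (fun k : ℤ => c.eval (k : ℂ) * ((μ ^ k : ℂˣ) : ℂ)) =
      fun k : ℤ => (C (μ : ℂ) * (c.comp (X + C 1) - c)).eval (k : ℂ) * ((μ ^ k : ℂˣ) : ℂ) := by
    ext k
    simp only [shift, LinearMap.sub_apply, LinearMap.coe_mk, AddHom.coe_mk, Pi.sub_apply,
      LinearMap.smul_apply, Module.End.one_apply, Pi.smul_apply, smul_eq_mul, zpow_add_one,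
      Units.val_mul, eval_mul, eval_C, eval_sub, eval_comp, eval_add, eval_X]
    push_cast
    ring
  rcases Nat.eq_zero_or_pos d with h0 | hpos
  · refine ⟨1, ?_⟩
    obtain ⟨a, rfl⟩ := natDegree_eq_zero.mp (hd.trans h0)
    rw [pow_one, key]
    ext k
    simp
  · have hlt : (C (μ : ℂ) * (c.comp (X + C 1) - c)).natDegree < d := by
      refine (natDegree_C_mul_le _ _).trans_lt ?_
      have hc : c ≠ 0 := by rintro rfl; simp at hd; omega
      have hdeg : (c.comp (X + C 1)).natDegree = c.natDegree := by
        rw [natDegree_comp, natDegree_X_add_C, mul_one]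
      have hc' : c.comp (X + C 1) ≠ 0 := by
        intro h; rw [h] at hdeg; simp at hdeg; omega
      rcases eq_or_ne (c.comp (X + C 1) - c) 0 with h | h
      · rw [h]; simpa using hpos
      · rw [← hd, ← hdeg]
        refine natDegree_lt_natDegree h (degree_sub_lt_left ?_ hc' ?_)
        · rw [degree_eq_natDegree hc, degree_eq_natDegree hc', hdeg]
        · rw [leadingCoeff_comp (by rw [natDegree_X_add_C]; exact one_ne_zero),
            leadingCoeff_X_add_C, one_pow, mul_one]
    obtain ⟨m, hm⟩ := ih _ hlt _ rfl
    refine ⟨m + 1, ?_⟩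
    rw [pow_succ, Module.End.mul_apply, key, hm]

theorem eq_zero_of_eval_intCast (c : ℂ[X]) (h : ∀ k : ℤ, c.eval (k : ℂ) = 0) : c = 0 :=
  eq_zero_of_infinite_isRoot c
    ((Set.infinite_range_of_injective (Int.cast_injective (α := ℂ))).mono
      (by rintro _ ⟨k, rfl⟩; exact h k))

variable {M : Subgroup ℂˣ}

/-- An element of `ℂ[X][M]` read as the exponential polynomial `∑ c_μ(k) μ ^ k` and evaluated at
the integer `k`. -/
def evalExpPoly (M : Subgroup ℂˣ) (k : ℤ) : MonoidAlgebra ℂ[X] M →+* ℂ :=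
  MonoidAlgebra.liftNCRingHom (evalRingHom (k : ℂ))
    ((Units.coeHom ℂ).comp ((zpowGroupHom k).comp M.subtype)) (fun _ _ => Commute.all _ _)

theorem evalExpPoly_single (k : ℤ) (μ : M) (c : ℂ[X]) :
    evalExpPoly M k (MonoidAlgebra.single μ c) = c.eval (k : ℂ) * (((μ : ℂˣ) ^ k : ℂˣ) : ℂ) := by
  simp [evalExpPoly]

/-- An exponential polynomial that vanishes at all integers is zero: its terms lie in independent
generalised eigenspaces of the shift, so each `c_μ(k) μ ^ k` vanishes for all `k`. -/
theorem eq_zero_of_evalExpPoly (f : MonoidAlgebra ℂ[X] M) (h : ∀ k, evalExpPoly M k f = 0) :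
    f = 0 := by
  have hind : iSupIndep fun μ : M => shift.maxGenEigenspace ((μ : ℂˣ) : ℂ) :=
    shift.independent_maxGenEigenspace.comp
      (Units.val_injective.comp Subtype.val_injective)
  rw [iSupIndep_iff_finsetSum_eq_zero_imp_eq_zero] at hind
  have hsum : ∀ k, evalExpPoly M k f =
      ∑ μ ∈ f.coeff.support, (f.coeff μ).eval (k : ℂ) * (((μ : ℂˣ) ^ k : ℂˣ) : ℂ) := by
    intro k
    simp [evalExpPoly, MonoidAlgebra.liftNCRingHom, MonoidAlgebra.liftNC, Finsupp.sum]
  have h0 := hind f.coeff.support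
    (fun μ => fun k : ℤ => (f.coeff μ).eval (k : ℂ) * (((μ : ℂˣ) ^ k : ℂˣ) : ℂ))
    (fun μ _ => mem_maxGenEigenspace_shift _ _) (by
      ext k
      simpa [hsum] using h k)
  ext1
  ext1 μ
  by_contra hne
  refine hne (eq_zero_of_eval_intCast _ fun k => ?_)
  exact (mul_eq_zero.mp (congrFun (h0 μ (Finsupp.mem_support_iff.mpr hne)) k)).resolve_right
    (Units.ne_zero _)

/-- The entries of `u ^ k`, for `u` unipotent, are polynomials in `k ∈ ℤ`. For `k ≥ 0` this is the
binomial expansion of `(1 + (u - 1)) ^ k`. -/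
theorem exists_polynomial_zpow_of_isNilpotent {n : ℕ} (u : GL (Fin n) ℂ)
    (hu : IsNilpotent ((u : Matrix (Fin n) (Fin n) ℂ) - 1)) :
    ∃ P : Matrix (Fin n) (Fin n) ℂ[X], ∀ (k : ℤ) (i j : Fin n),
      ((u ^ k : GL (Fin n) ℂ) : Matrix (Fin n) (Fin n) ℂ) i j = (P i j).eval (k : ℂ) := by
  obtain ⟨d, hd⟩ := hu
  set N : Matrix (Fin n) (Fin n) ℂ := (u : Matrix (Fin n) (Fin n) ℂ) - 1 with hN
  let P : Matrix (Fin n) (Fin n) ℂ[X] := Matrix.of fun i j =>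
    ∑ l ∈ Finset.range d, C ((N ^ l) i j / (l.factorial : ℂ)) * descPochhammer ℂ l
  have hnat : ∀ (k : ℕ) (i j : Fin n),
      ((u : Matrix (Fin n) (Fin n) ℂ) ^ k) i j = (P i j).eval (k : ℂ) := by
    intro k i j
    have hterm : ∀ l : ℕ, (N ^ l * 1 ^ (k - l) * (k.choose l : Matrix (Fin n) (Fin n) ℂ)) i j =
        (C ((N ^ l) i j / (l.factorial : ℂ)) * descPochhammer ℂ l).eval (k : ℂ) := by
      intro l
      rw [one_pow, mul_one, eval_mul, eval_C, descPochhammer_eval_eq_descFactorial,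
        Nat.descFactorial_eq_factorial_mul_choose, ← nsmul_eq_mul', Matrix.smul_apply]
      have : (l.factorial : ℂ) ≠ 0 := by exact_mod_cast l.factorial_ne_zero
      push_cast
      rw [nsmul_eq_mul]
      field_simp
    rw [show (u : Matrix (Fin n) (Fin n) ℂ) = N + 1 by rw [hN, sub_add_cancel],
      (Commute.one_right N).add_pow, Matrix.sum_apply]
    simp only [P, Matrix.of_apply, eval_finsetSum]
    rw [Finset.sum_congr rfl fun l _ => hterm l]
    trans ∑ l ∈ Finset.range (k + 1 + d),
      (C ((N ^ l) i j / (l.factorial : ℂ)) * descPochhammer ℂ l).eval (k : ℂ)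
    · refine Finset.sum_subset (Finset.range_mono (by omega)) fun l _ hl => ?_
      rw [← hterm, Nat.choose_eq_zero_of_lt (by simpa using hl)]
      simp
    · refine (Finset.sum_subset (Finset.range_mono (by omega)) fun l _ hl => ?_).symm
      rw [pow_eq_zero_of_le (by simpa using hl) hd]
      simp
  -- The recursion `u ^ (k + 1) = u ^ k * u` is a polynomial identity in `k`, hence propagates
  -- from the natural numbers to all integers.
  have hrec : ∀ i j, (P i j).comp (X + C 1) =
      ∑ l, P i l * C ((u : Matrix (Fin n) (Fin n) ℂ) l j) := by
    intro i j
    refine eq_of_infinite_eval_eq _ _ ((Set.infinite_range_of_injective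
      (Nat.cast_injective (R := ℂ))).mono ?_)
    rintro _ ⟨k, rfl⟩
    have h1 := hnat (k + 1) i j
    rw [pow_succ, Matrix.mul_apply] at h1
    simp only [hnat] at h1
    simp only [Set.mem_ofPred_eq, eval_comp, eval_add, eval_X, eval_C, eval_finsetSum, eval_mul]
    push_cast at h1
    exact h1.symm
  have hstep : ∀ k : ℤ, P.map (eval ((k + 1 : ℤ) : ℂ)) = P.map (eval (k : ℂ)) * u := by
    intro k
    ext i j
    have h1 := congrArg (eval (k : ℂ)) (hrec i j)
    simp only [eval_comp, eval_add, eval_X, eval_C, eval_finsetSum, eval_mul] at h1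
    simpa [Matrix.mul_apply] using h1
  have hall : ∀ k : ℤ, ((u ^ k : GL (Fin n) ℂ) : Matrix (Fin n) (Fin n) ℂ) =
      P.map (eval (k : ℂ)) := by
    intro k
    induction k using Int.induction_on with
    | zero =>
      ext i j
      simpa using hnat 0 i j
    | succ k ih => rw [hstep, ← ih, zpow_add_one, Units.val_mul]
    | pred k ih =>
      have h1 := hstep (-(k : ℤ) - 1)
      rw [sub_add_cancel, ← ih] at h1
      rw [zpow_sub_one, Units.val_mul, h1, mul_assoc, ← Units.val_mul, mul_inv_cancel,
        Units.val_one, mul_one]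
  exact ⟨P, fun k i j => by rw [hall k]; rfl⟩

end ExponentialPolynomials

variable {n : ℕ}

/-! ### The Zariski closure of a cyclic group -/

theorem evalAt_aeval (φ : Fin n × Fin n → MvPolynomial (Fin n × Fin n) ℂ)
    (p : MvPolynomial (Fin n × Fin n) ℂ) (x : GL (Fin n) ℂ) :
    evalAt x (MvPolynomial.aeval φ p) = MvPolynomial.eval (fun ij => evalAt x (φ ij)) p := by
  induction p using MvPolynomial.induction_on with
  | C a => simp [evalAt]
  | add p q hp hq => simp only [map_add, evalAt] at *; rw [hp, hq]
  | mul_X p ij hp =>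
    simp only [map_mul, evalAt, MvPolynomial.aeval_X, MvPolynomial.eval_X] at *
    rw [hp]

theorem exists_evalAt_mul_left (a : GL (Fin n) ℂ) (p : MvPolynomial (Fin n × Fin n) ℂ) :
    ∃ q, ∀ x, evalAt x q = evalAt (a * x) p := by
  refine ⟨MvPolynomial.aeval (fun ij => ∑ l, MvPolynomial.C ((a : Matrix _ _ ℂ) ij.1 l) *
    MvPolynomial.X (l, ij.2)) p, fun x => ?_⟩
  rw [evalAt_aeval]
  simp [evalAt, Matrix.mul_apply]

theorem exists_evalAt_mul_right (a : GL (Fin n) ℂ) (p : MvPolynomial (Fin n × Fin n) ℂ) :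
    ∃ q, ∀ x, evalAt x q = evalAt (x * a) p := by
  refine ⟨MvPolynomial.aeval (fun ij => ∑ l, MvPolynomial.X (ij.1, l) *
    MvPolynomial.C ((a : Matrix _ _ ℂ) l ij.2)) p, fun x => ?_⟩
  rw [evalAt_aeval]
  simp [evalAt, Matrix.mul_apply]

/-- The determinant as a polynomial in the matrix entries. -/
def detPoly (n : ℕ) : MvPolynomial (Fin n × Fin n) ℂ :=
  (Matrix.mvPolynomialX (Fin n) (Fin n) ℂ).det

theorem mvPolynomialX_map_evalAt (x : GL (Fin n) ℂ) :
    (Matrix.mvPolynomialX (Fin n) (Fin n) ℂ).map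
      (MvPolynomial.eval fun ij : Fin n × Fin n => (x : Matrix (Fin n) (Fin n) ℂ) ij.1 ij.2) =
      x := by
  ext i j
  simp

theorem evalAt_detPoly (x : GL (Fin n) ℂ) :
    evalAt x (detPoly n) = (x : Matrix (Fin n) (Fin n) ℂ).det := by
  rw [evalAt, detPoly, RingHom.map_det, RingHom.mapMatrix_apply, mvPolynomialX_map_evalAt]

theorem det_coe_ne_zero (x : GL (Fin n) ℂ) : (x : Matrix (Fin n) (Fin n) ℂ).det ≠ 0 :=
  ((Matrix.isUnit_iff_isUnit_det _).mp x.isUnit).ne_zero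

theorem inv_apply_mul_det (x : GL (Fin n) ℂ) (i j : Fin n) :
    ((x⁻¹ : GL (Fin n) ℂ) : Matrix (Fin n) (Fin n) ℂ) i j * (x : Matrix (Fin n) (Fin n) ℂ).det =
      evalAt x ((Matrix.mvPolynomialX (Fin n) (Fin n) ℂ).adjugate i j) := by
  have h1 : evalAt x ((Matrix.mvPolynomialX (Fin n) (Fin n) ℂ).adjugate i j) =
      (x : Matrix (Fin n) (Fin n) ℂ).adjugate i j := by
    conv_rhs => rw [← mvPolynomialX_map_evalAt x, ← RingHom.mapMatrix_apply, ← RingHom.map_adjugate]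
    rfl
  rw [h1, Matrix.coe_units_inv, Matrix.inv_def, Ring.inverse_eq_inv', Matrix.smul_apply,
    smul_eq_mul]
  field_simp [det_coe_ne_zero x]

/-- Inversion is regular: up to a power of the determinant, `p(x⁻¹)` is a polynomial in the entries
of `x`. -/
theorem exists_evalAt_inv (p : MvPolynomial (Fin n × Fin n) ℂ) :
    ∃ (q : MvPolynomial (Fin n × Fin n) ℂ) (k : ℕ), ∀ x : GL (Fin n) ℂ,
      evalAt x⁻¹ p * (x : Matrix (Fin n) (Fin n) ℂ).det ^ k = evalAt x q := by
  induction p using MvPolynomial.induction_on with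
  | C a => exact ⟨MvPolynomial.C a, 0, fun x => by simp [evalAt]⟩
  | add p q hp hq =>
    obtain ⟨p', k, hp⟩ := hp
    obtain ⟨q', l, hq⟩ := hq
    refine ⟨p' * detPoly n ^ l + q' * detPoly n ^ k, k + l, fun x => ?_⟩
    have h1 := hp x
    have h2 := hq x
    have h3 := evalAt_detPoly x
    simp only [evalAt, map_add, map_mul, map_pow] at *
    rw [← h1, ← h2, h3]
    ring
  | mul_X p ij hp =>
    obtain ⟨p', k, hp⟩ := hp
    refine ⟨p' * (Matrix.mvPolynomialX (Fin n) (Fin n) ℂ).adjugate ij.1 ij.2, k + 1, fun x => ?_⟩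
    have h1 := hp x
    have h3 := inv_apply_mul_det x ij.1 ij.2
    simp only [evalAt, map_mul, MvPolynomial.eval_X] at *
    rw [← h1, ← h3]
    ring

/-- The Zariski closure of `{g ^ k | k ∈ ℤ}`, described as the common zeros of all polynomials
vanishing on the powers of `g`; translations and inversion being polynomial up to powers of the
determinant, it is a subgroup. -/
def zariskiClosureZPowers (g : GL (Fin n) ℂ) : Subgroup (GL (Fin n) ℂ) where
  carrier := {h | ∀ p, (∀ k : ℤ, evalAt (g ^ k) p = 0) → evalAt h p = 0}
  one_mem' p hp := by simpa using hp 0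
  mul_mem' := by
    intro a b ha hb p hp
    obtain ⟨q, hq⟩ := exists_evalAt_mul_right b p
    rw [← hq]
    refine ha q fun k => ?_
    obtain ⟨r, hr⟩ := exists_evalAt_mul_left (g ^ k) p
    rw [hq, ← hr]
    refine hb r fun l => ?_
    rw [hr, ← zpow_add]
    exact hp _
  inv_mem' := by
    intro a ha p hp
    obtain ⟨q, k, hq⟩ := exists_evalAt_inv p
    have h := ha q fun l => by rw [← hq, ← zpow_neg, hp, zero_mul]
    rw [← hq] at h
    exact (mul_eq_zero.mp h).resolve_right (pow_ne_zero _ (det_coe_ne_zero a))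

theorem isClosed_iff_zeroSet (Z : Set (GL (Fin n) ℂ)) :
    IsClosed[zariskiTopology n] Z ↔ ∃ S, zeroSet S = Z := by
  let _ := zariskiTopology n
  rw [← isOpen_compl_iff]
  change Zᶜᶜ ∈ Set.range zeroSet ↔ _
  rw [compl_compl]
  rfl

theorem closedHull_eq {G : Subgroup (GL (Fin n) ℂ)} (hG : IsZariskiClosed G)
    {g : GL (Fin n) ℂ} (hg : g ∈ G) : closedHull G g = zariskiClosureZPowers g := by
  apply le_antisymm
  · refine sInf_le ⟨?_, ?_, ?_⟩
    · obtain ⟨S, hS⟩ := (isClosed_iff_zeroSet _).mp hG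
      intro h hh
      rw [← SetLike.mem_coe, ← hS]
      refine fun p hp => hh p fun k => ?_
      have : g ^ k ∈ zeroSet S := hS ▸ G.zpow_mem hg k
      exact this p hp
    · refine (isClosed_iff_zeroSet _).mpr ⟨{p | ∀ k : ℤ, evalAt (g ^ k) p = 0}, ?_⟩
      rfl
    · intro p hp
      simpa using hp 1
  · refine le_sInf ?_
    rintro H ⟨-, hH, hgH⟩ h hh
    obtain ⟨S, hS⟩ := (isClosed_iff_zeroSet _).mp hH
    rw [← SetLike.mem_coe, ← hS]
    refine fun p hp => hh p fun k => ?_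
    have : g ^ k ∈ zeroSet S := hS ▸ H.zpow_mem hgH k
    exact this p hp

/-- If the ideal of polynomials vanishing on the powers of `g` is prime, then the closure of the
powers is irreducible, hence connected. -/
theorem isZariskiConnected_of_prime (g : GL (Fin n) ℂ)
    (h : ∀ p q, (∀ k : ℤ, evalAt (g ^ k) (p * q) = 0) →
      (∀ k : ℤ, evalAt (g ^ k) p = 0) ∨ ∀ k : ℤ, evalAt (g ^ k) q = 0) :
    IsZariskiConnected (zariskiClosureZPowers g) := by
  let _ := zariskiTopology n
  refine ⟨⟨1, one_mem _⟩, IsPreirreducible.isPreconnected ?_⟩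
  rw [isPreirreducible_iff_isClosed_union_isClosed]
  intro Z Z' hZ hZ' hsub
  obtain ⟨S, rfl⟩ := (isClosed_iff_zeroSet _).mp hZ
  obtain ⟨S', rfl⟩ := (isClosed_iff_zeroSet _).mp hZ'
  by_contra! hcon
  obtain ⟨h1, h2⟩ := hcon
  have aux : ∀ S : Set (MvPolynomial (Fin n × Fin n) ℂ),
      ¬ (zariskiClosureZPowers g : Set (GL (Fin n) ℂ)) ⊆ zeroSet S →
      ∃ p ∈ S, ¬ ∀ k : ℤ, evalAt (g ^ k) p = 0 := by
    intro S hS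
    by_contra! hc
    exact hS fun x hx p hp => hx p (hc p hp)
  obtain ⟨p, hp, hp'⟩ := aux S h1
  obtain ⟨q, hq, hq'⟩ := aux S' h2
  refine (h p q fun k => ?_).elim hp' hq'
  have hk : g ^ k ∈ zariskiClosureZPowers g := fun p hp => hp k
  rw [evalAt, map_mul]
  rcases hsub hk with hk | hk
  · exact mul_eq_zero_of_left (hk p hp) _
  · exact mul_eq_zero_of_right _ (hk q hq)

/-- If a polynomial `q` takes the value `ζ ^ k det ^ K` at `g ^ k`, where `ζ ^ m = 1`, then the
closure of the powers of `g` is the disjoint union of its closed subsets `q = det ^ K` and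
`(q ^ m - det ^ (K m)) / (q - det ^ K) = 0`. -/
theorem eq_one_of_isZariskiConnected {g : GL (Fin n) ℂ}
    (hconn : IsZariskiConnected (zariskiClosureZPowers g))
    {q : MvPolynomial (Fin n × Fin n) ℂ} {K m : ℕ} {ζ : ℂ} (hm : m ≠ 0) (hζ : ζ ^ m = 1)
    (hq : ∀ k : ℤ, evalAt (g ^ k) q = ζ ^ k * evalAt (g ^ k) (detPoly n) ^ K) : ζ = 1 := by
  let _ := zariskiTopology n
  set D := detPoly n ^ K with hD
  have hD0 : ∀ x : GL (Fin n) ℂ, evalAt x D ≠ 0 := fun x => by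
    have h := evalAt_detPoly x
    rw [evalAt] at h ⊢
    rw [hD, map_pow, h]
    exact pow_ne_zero _ (det_coe_ne_zero x)
  have hqD : ∀ k : ℤ, evalAt (g ^ k) q = ζ ^ k * evalAt (g ^ k) D := fun k => by
    rw [hq, hD, evalAt, evalAt, map_pow]
  set r := ∑ i ∈ Finset.range m, q ^ i * D ^ (m - 1 - i) with hr
  have hgeom : r * (q - D) = q ^ m - D ^ m := (Commute.all q D).geom_sum₂_mul m
  have hsub : (zariskiClosureZPowers g : Set (GL (Fin n) ℂ)) ⊆
      zeroSet {q - D} ∪ zeroSet {r} := by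
    intro x hx
    have h0 : evalAt x (r * (q - D)) = 0 := hx _ fun k => by
      have h := hqD k
      rw [hgeom]
      simp only [evalAt, map_sub, map_pow] at h ⊢
      rw [h, mul_pow, ← zpow_natCast, ← zpow_mul, mul_comm k, zpow_mul, zpow_natCast, hζ, one_zpow,
        one_mul, sub_self]
    rw [evalAt, map_mul] at h0
    rcases mul_eq_zero.mp h0 with h | h
    · exact Or.inr (by rintro _ rfl; exact h)
    · exact Or.inl (by rintro _ rfl; rw [evalAt, map_sub]; simpa using h)
  have hg : g ∈ zariskiClosureZPowers g := fun p hp => by simpa using hp 1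
  rcases hsub hg with h | h
  · have h1 : evalAt g (q - D) = 0 := h _ rfl
    have h2 := hqD 1
    rw [evalAt, map_sub, sub_eq_zero] at h1
    rw [zpow_one, zpow_one, evalAt, h1] at h2
    exact (mul_eq_right₀ (hD0 g)).mp h2.symm
  · exfalso
    obtain ⟨x, -, hx1, hx2⟩ := isPreconnected_closed_iff.mp hconn.isPreconnected
      (zeroSet {q - D}) (zeroSet {r})
      ((isClosed_iff_zeroSet _).mpr ⟨_, rfl⟩) ((isClosed_iff_zeroSet _).mpr ⟨_, rfl⟩) hsub
      ⟨1, one_mem _, by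
        have h := hqD 0
        rw [zpow_zero, zpow_zero, one_mul, evalAt, evalAt] at h
        rintro _ rfl
        rw [evalAt, map_sub, h, sub_self]⟩
      ⟨g, hg, h⟩
    have h1 : evalAt x (q - D) = 0 := hx1 _ rfl
    have h2 : evalAt x r = 0 := hx2 _ rfl
    have h3 := hD0 x
    rw [evalAt, map_sub, sub_eq_zero] at h1
    rw [evalAt, hr] at h2
    simp only [map_sum, map_mul, map_pow, h1] at h2
    rw [Finset.sum_congr rfl (g := fun _ => evalAt x D ^ (m - 1)) fun i hi => by
      rw [← pow_add, evalAt]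
      congr 1
      have := Finset.mem_range.mp hi
      omega] at h2
    rw [Finset.sum_const, Finset.card_range, nsmul_eq_mul] at h2
    exact mul_ne_zero (Nat.cast_ne_zero.mpr hm) (pow_ne_zero _ h3) h2

/-! ### The semisimple part -/

theorem IsSemisimpleMatrix.of_mem_adjoin {A B : Matrix (Fin n) (Fin n) ℂ}
    (hA : IsSemisimpleMatrix A) (hB : B ∈ Algebra.adjoin ℂ {A}) : IsSemisimpleMatrix B := by
  rw [Algebra.adjoin_singleton_eq_range_aeval] at hB
  obtain ⟨p, rfl⟩ := hB
  have h : Matrix.toLin' ((Polynomial.aeval A) p) = Polynomial.aeval (Matrix.toLin' A) p :=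
    (Polynomial.aeval_algHom_apply (Matrix.toLinAlgEquiv' (R := ℂ) (n := Fin n)) A p).symm
  change Module.End.IsSemisimple (Matrix.toLin' (Polynomial.aeval A p) : Module.End ℂ (Fin n → ℂ))
  rw [h]
  exact Module.End.IsSemisimple.aeval hA p

theorem IsSemisimpleMatrix.eq_zero_of_isNilpotent {A : Matrix (Fin n) (Fin n) ℂ}
    (hA : IsSemisimpleMatrix A) (hA' : IsNilpotent A) : A = 0 := by
  have h : Matrix.toLin' A = 0 := Module.End.eq_zero_of_isNilpotent_isSemisimple
    (hA'.map (Matrix.toLinAlgEquiv' (R := ℂ) (n := Fin n))) hA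
  exact Matrix.toLin'.map_eq_zero_iff.mp h

theorem zpow_mem_adjoin (s : GL (Fin n) ℂ) (k : ℤ) :
    ((s ^ k : GL (Fin n) ℂ) : Matrix (Fin n) (Fin n) ℂ) ∈
      Algebra.adjoin ℂ {(s : Matrix (Fin n) (Fin n) ℂ)} := by
  set B := Algebra.adjoin ℂ {(s : Matrix (Fin n) (Fin n) ℂ)}
  have hs : (s : Matrix (Fin n) (Fin n) ℂ) ∈ B := Algebra.subset_adjoin rfl
  -- Multiplication by `s` is injective, hence surjective, on the finite-dimensional algebra `ℂ[s]`.
  have hinv : ((s⁻¹ : GL (Fin n) ℂ) : Matrix (Fin n) (Fin n) ℂ) ∈ B := by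
    have hinj : Function.Injective (LinearMap.mulLeft ℂ (⟨s, hs⟩ : B)) := by
      intro x y hxy
      have h : (s : Matrix (Fin n) (Fin n) ℂ) * x = s * y := congrArg Subtype.val hxy
      exact Subtype.ext (s.isUnit.mul_left_cancel h)
    obtain ⟨v, hv⟩ := LinearMap.injective_iff_surjective.mp hinj 1
    have hv' : (s : Matrix (Fin n) (Fin n) ℂ) * v = 1 := congrArg Subtype.val hv
    rw [Units.inv_eq_of_mul_eq_one_right hv']
    exact v.2
  induction k using Int.induction_on with
  | zero => simp
  | succ k ih => rw [zpow_add_one, Units.val_mul]; exact mul_mem ih hs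
  | pred k ih => rw [zpow_sub_one, Units.val_mul]; exact mul_mem ih hinv

/-- `u - 1` divides `u ^ k - 1` in `ℂ[u]`, also for negative `k`. -/
theorem exists_zpow_sub_one_eq_mul (u : GL (Fin n) ℂ) (k : ℤ) :
    ∃ w : Matrix (Fin n) (Fin n) ℂ, w ∈ Algebra.adjoin ℂ {(u : Matrix (Fin n) (Fin n) ℂ)} ∧
      ((u ^ k : GL (Fin n) ℂ) : Matrix (Fin n) (Fin n) ℂ) - 1 = (u - 1) * w := by
  have hu : (u : Matrix (Fin n) (Fin n) ℂ) ∈ Algebra.adjoin ℂ {(u : Matrix (Fin n) (Fin n) ℂ)} :=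
    Algebra.subset_adjoin rfl
  have huinv := zpow_mem_adjoin u (-1)
  rw [zpow_neg_one] at huinv
  induction k using Int.induction_on with
  | zero => exact ⟨0, zero_mem _, by simp⟩
  | succ k ih =>
    obtain ⟨w, hw, h⟩ := ih
    refine ⟨w * u + 1, add_mem (mul_mem hw hu) (one_mem _), ?_⟩
    rw [zpow_add_one, Units.val_mul, mul_add, ← mul_assoc, ← h]
    noncomm_ring
  | pred k ih =>
    obtain ⟨w, hw, h⟩ := ih
    refine ⟨(w - 1) * (u⁻¹ : GL (Fin n) ℂ), mul_mem (sub_mem hw (one_mem _)) huinv, ?_⟩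
    rw [zpow_sub_one, Units.val_mul, ← mul_assoc, mul_sub, ← h, mul_one]
    simp only [sub_mul, one_mul, Units.mul_inv]
    noncomm_ring

/-- For commuting `s` semisimple and `u` unipotent, `(s u) ^ k = s ^ k + (u - 1) x` where `x`
commutes with `u - 1`. The matrices `(u - 1) x` of this kind form a space of nilpotent matrices, which meets
the space `ℂ[s]` of semisimple matrices only in `0`; so some linear map fixes `ℂ[s]` and kills
them. -/
theorem exists_linearMap_zpow_eq {s u : GL (Fin n) ℂ} (hsu : Commute s u)
    (hs : IsSemisimpleMatrix (s : Matrix (Fin n) (Fin n) ℂ))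
    (hu : IsNilpotent ((u : Matrix (Fin n) (Fin n) ℂ) - 1)) :
    ∃ π : Matrix (Fin n) (Fin n) ℂ →ₗ[ℂ] Matrix (Fin n) (Fin n) ℂ,
      ∀ k : ℤ, π (((s * u) ^ k : GL (Fin n) ℂ) : Matrix (Fin n) (Fin n) ℂ) =
        ((s ^ k : GL (Fin n) ℂ) : Matrix (Fin n) (Fin n) ℂ) := by
  let V := Subalgebra.toSubmodule (Algebra.adjoin ℂ {(s : Matrix (Fin n) (Fin n) ℂ)})
  let N : Matrix (Fin n) (Fin n) ℂ := (u : Matrix (Fin n) (Fin n) ℂ) - 1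
  let W := (Subalgebra.toSubmodule (Subalgebra.centralizer ℂ {N})).map (LinearMap.mulLeft ℂ N)
  have hVW : Disjoint V W := by
    rw [Submodule.disjoint_def]
    rintro _ hV ⟨x, hx, rfl⟩
    refine (hs.of_mem_adjoin hV).eq_zero_of_isNilpotent ?_
    have hc : Commute N x := (Subalgebra.mem_centralizer_iff ℂ).mp hx N rfl
    exact hc.isNilpotent_mul_right hu
  obtain ⟨V', hVV', hcompl⟩ := hVW.exists_isCompl
  refine ⟨V'.projection W hcompl, fun k => ?_⟩
  obtain ⟨w, hw, hwk⟩ := exists_zpow_sub_one_eq_mul u k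
  have hsu' : Commute (s : Matrix (Fin n) (Fin n) ℂ) u := congrArg Units.val hsu
  have hNu : Commute N (u : Matrix (Fin n) (Fin n) ℂ) :=
    (Commute.refl _).sub_left (Commute.one_left _)
  have hNs : Commute N (s : Matrix (Fin n) (Fin n) ℂ) := hsu'.symm.sub_left (Commute.one_left _)
  have hcent : ∀ {a x : Matrix (Fin n) (Fin n) ℂ}, Commute N a → x ∈ Algebra.adjoin ℂ {a} →
      x ∈ Subalgebra.centralizer ℂ {N} := by
    intro a x ha hx
    refine Algebra.adjoin_le ?_ hx
    rw [Set.singleton_subset_iff, SetLike.mem_coe, Subalgebra.mem_centralizer_iff]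
    rintro _ rfl
    exact ha
  have hsk := hcent hNs (zpow_mem_adjoin s k)
  have hcomm : N * ((s ^ k : GL (Fin n) ℂ) : Matrix (Fin n) (Fin n) ℂ) =
      (s ^ k : GL (Fin n) ℂ) * N :=
    (Subalgebra.mem_centralizer_iff ℂ).mp hsk N rfl
  have hdec : (((s * u) ^ k : GL (Fin n) ℂ) : Matrix (Fin n) (Fin n) ℂ) =
      (s ^ k : GL (Fin n) ℂ) + N * ((s ^ k : GL (Fin n) ℂ) * w) := by
    rw [← mul_assoc, hcomm, mul_assoc, ← hwk, hsu.mul_zpow, Units.val_mul]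
    noncomm_ring
  have hmem : N * (((s ^ k : GL (Fin n) ℂ) : Matrix (Fin n) (Fin n) ℂ) * w) ∈ W :=
    ⟨_, Subalgebra.mul_mem _ hsk (hcent hNu hw), rfl⟩
  rw [hdec, map_add, Submodule.projection_apply_of_mem_left _ (hVV' (zpow_mem_adjoin s k)),
    (Submodule.projection_apply_eq_zero_iff hcompl).mpr hmem, add_zero]

theorem det_eq_one_of_isNilpotent_sub_one {A : Matrix (Fin n) (Fin n) ℂ}
    (hA : IsNilpotent (A - 1)) : A.det = 1 := by
  have h : (Matrix.toLin' (1 - A)).charpoly = Polynomial.X ^ n := by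
    rw [IsNilpotent.charpoly_eq_X_pow_finrank]
    · simp
    · rw [← neg_sub]
      exact (hA.neg).map (Matrix.toLinAlgEquiv' (R := ℂ) (n := Fin n))
  rw [Matrix.charpoly_toLin'] at h
  have h1 := Matrix.eval_charpoly (1 - A) 1
  rw [h] at h1
  simpa using h1.symm

/-- A character value of finite order at `s` would disconnect the closure of the powers of `s u`. -/
theorem isMulTorsionFree_of_isZariskiConnected {s u : GL (Fin n) ℂ} (hsu : Commute s u)
    (hs : IsSemisimpleMatrix (s : Matrix (Fin n) (Fin n) ℂ))
    (hu : IsNilpotent ((u : Matrix (Fin n) (Fin n) ℂ) - 1))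
    {T : Subgroup (GL (Fin n) ℂ)} (hsT : s ∈ T)
    (hconn : IsZariskiConnected (zariskiClosureZPowers (s * u))) :
    IsMulTorsionFree (characterValues T ⟨s, hsT⟩) := by
  rw [isMulTorsionFree_iff_not_isOfFinOrder]
  rintro ⟨_, χ, hχ, rfl⟩ hne hfin
  obtain ⟨m, hm, hpow⟩ := isOfFinOrder_iff_pow_eq_one.mp hfin
  obtain ⟨p, K, hp⟩ := hχ.1
  obtain ⟨π, hπ⟩ := exists_linearMap_zpow_eq hsu hs hu
  apply hne
  -- `q` is the numerator `p` of `χ`, composed with `π`.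
  let q := MvPolynomial.aeval (fun ij : Fin n × Fin n => ∑ a, ∑ b,
    MvPolynomial.C (π (Matrix.single a b 1) ij.1 ij.2) * MvPolynomial.X (a, b)) p
  have hq : ∀ x : GL (Fin n) ℂ, evalAt x q =
      MvPolynomial.eval (fun ij => π (x : Matrix (Fin n) (Fin n) ℂ) ij.1 ij.2) p := by
    intro x
    rw [evalAt_aeval]
    congr 2
    ext ij
    conv_rhs => rw [Matrix.matrix_eq_sum_single (x : Matrix (Fin n) (Fin n) ℂ)]
    simp only [evalAt, map_sum, map_mul, MvPolynomial.eval_C, MvPolynomial.eval_X, Matrix.sum_apply]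
    refine Finset.sum_congr rfl fun a _ => Finset.sum_congr rfl fun b _ => ?_
    have h : Matrix.single a b ((x : Matrix (Fin n) (Fin n) ℂ) a b) =
        (x : Matrix (Fin n) (Fin n) ℂ) a b • Matrix.single a b (1 : ℂ) := by
      rw [Matrix.smul_single, smul_eq_mul, mul_one]
    rw [h, map_smul, Matrix.smul_apply, smul_eq_mul, mul_comm]
  have h1 := eq_one_of_isZariskiConnected hconn (q := q) (K := K) (m := m)
    (ζ := (χ ⟨s, hsT⟩ : ℂ)) hm.ne' (by
      rw [← Units.val_pow_eq_pow_val]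
      exact congrArg (fun z : characterValues T ⟨s, hsT⟩ => ((z : ℂˣ) : ℂ)) hpow) (by
    intro k
    have h2 := hp (⟨s, hsT⟩ ^ k)
    have hdet : evalAt ((s * u) ^ k) (detPoly n) =
        ((s ^ k : GL (Fin n) ℂ) : Matrix (Fin n) (Fin n) ℂ).det := by
      have hu1 : Matrix.GeneralLinearGroup.det u = 1 :=
        Units.ext (det_eq_one_of_isNilpotent_sub_one hu)
      rw [evalAt_detPoly]
      change ((Matrix.GeneralLinearGroup.det ((s * u) ^ k) : ℂˣ) : ℂ) =
        ((Matrix.GeneralLinearGroup.det (s ^ k) : ℂˣ) : ℂ)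
      rw [map_zpow, map_zpow, map_mul, hu1, mul_one]
    beta_reduce at h2
    rw [map_zpow, Units.val_zpow_eq_zpow_val] at h2
    rw [h2, hq, hπ, hdet]
    have h3 := det_coe_ne_zero (s ^ k)
    simp only [SubgroupClass.coe_zpow, evalAt]
    field_simp)
  exact Subtype.ext (Units.ext h1)

theorem IsRegular.comp_inv {T : Subgroup (GL (Fin n) ℂ)} {f : T → ℂ} (hf : IsRegular T f) :
    IsRegular T fun t => f t⁻¹ := by
  obtain ⟨p, k, hp⟩ := hf
  obtain ⟨q, l, hq⟩ := exists_evalAt_inv p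
  refine ⟨q * detPoly n ^ k, l, fun t => ?_⟩
  have h1 := hp t⁻¹
  have h2 := hq t
  have h3 := evalAt_detPoly (t : GL (Fin n) ℂ)
  have h4 := det_coe_ne_zero (t : GL (Fin n) ℂ)
  have h5 : ((t⁻¹ : T) : GL (Fin n) ℂ).1.det = (t : GL (Fin n) ℂ).1.det⁻¹ := by
    refine eq_inv_of_mul_eq_one_left ?_
    rw [← Matrix.det_mul]
    simp
  beta_reduce
  rw [h1, h5]
  simp only [evalAt, map_mul, map_pow, InvMemClass.coe_inv] at h2 h3 ⊢
  rw [h3, ← h2, inv_pow]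
  field_simp

/-- The polynomial functions on the powers of `s u` are exponential polynomials with exponents in a
finitely generated torsion-free group; these form a domain. -/
theorem isZariskiConnected_of_isMulTorsionFree {s u : GL (Fin n) ℂ} (hsu : Commute s u)
    (hu : IsNilpotent ((u : Matrix (Fin n) (Fin n) ℂ) - 1))
    {T : Subgroup (GL (Fin n) ℂ)} (hT : IsTorus T) (hsT : s ∈ T)
    (htf : IsMulTorsionFree (characterValues T ⟨s, hsT⟩)) :
    IsZariskiConnected (zariskiClosureZPowers (s * u)) := by
  obtain ⟨-, r, e, he, he'⟩ := hT
  -- `M` is generated by finitely many values, so that its group algebra is known to be a domain.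
  let M : Subgroup ℂˣ := Subgroup.closure (Set.range fun i => e ⟨s, hsT⟩ i)
  have hMle : M ≤ characterValues T ⟨s, hsT⟩ := by
    refine (Subgroup.closure_le _).mpr ?_
    rintro _ ⟨i, rfl⟩
    refine ⟨(Pi.evalMonoidHom (fun _ => ℂˣ) i).comp e.toMonoidHom, ⟨he i, ?_⟩, rfl⟩
    have := (he i).comp_inv
    simpa using this
  have : IsMulTorsionFree M := (Subgroup.inclusion_injective hMle).isMulTorsionFree
    (Subgroup.inclusion hMle)
  have : Monoid.FG M := by
    rw [← Group.fg_iff_monoid_fg, Group.fg_iff_subgroup_fg]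
    exact ⟨(Set.finite_range fun i => e ⟨s, hsT⟩ i).toFinset, by simp [M]⟩
  have : IsDomain (MonoidAlgebra (Polynomial ℂ) M) := inferInstance
  let z : Fin r → M := fun i => ⟨e ⟨s, hsT⟩ i, Subgroup.subset_closure ⟨i, rfl⟩⟩
  choose p K hp using he'
  obtain ⟨P, hP⟩ := exists_polynomial_zpow_of_isNilpotent u hu
  -- `E i j` is the `(i, j)` entry of `s ^ k` as an exponential polynomial in `k`.
  let E : Fin n → Fin n → MonoidAlgebra (Polynomial ℂ) M := fun i j =>
    MvPolynomial.eval₂ (MonoidAlgebra.singleOneRingHom.comp Polynomial.C)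
      (fun i => MonoidAlgebra.single (z i) 1) (p i j) *
      MonoidAlgebra.single ((∏ l, z l) ^ K i j)⁻¹ 1
  have hE : ∀ (k : ℤ) i j, evalExpPoly M k (E i j) =
      ((s ^ k : GL (Fin n) ℂ) : Matrix (Fin n) (Fin n) ℂ) i j := by
    intro k i j
    have h := hp i j (fun l => (z l : ℂˣ) ^ k)
    have hz : e.symm (fun l => (z l : ℂˣ) ^ k) = ⟨s, hsT⟩ ^ k := by
      rw [MulEquiv.symm_apply_eq, map_zpow]
      rfl
    beta_reduce at h
    rw [hz, SubgroupClass.coe_zpow] at h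
    rw [h]
    simp only [E, map_mul, evalExpPoly_single, Polynomial.eval_one, one_mul]
    rw [MvPolynomial.hom_eval₂, div_eq_mul_inv]
    congr 1
    · rw [← MvPolynomial.eval₂_id]
      congr 1
      · ext a
        simp [MonoidAlgebra.singleOneRingHom, evalExpPoly_single]
      · ext l
        simp [evalExpPoly_single]
    · simp [Finset.prod_zpow, ← zpow_natCast, ← zpow_mul, mul_comm]
  -- `F (i, j)` is the `(i, j)` entry of `(s * u) ^ k` as an exponential polynomial in `k`.
  let F : Fin n × Fin n → MonoidAlgebra (Polynomial ℂ) M := fun ij =>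
    ∑ l, E ij.1 l * MonoidAlgebra.single 1 (P l ij.2)
  have hF : ∀ (k : ℤ) (f : MvPolynomial (Fin n × Fin n) ℂ),
      evalExpPoly M k (MvPolynomial.eval₂ (MonoidAlgebra.singleOneRingHom.comp Polynomial.C) F f) =
        evalAt ((s * u) ^ k) f := by
    intro k f
    rw [MvPolynomial.hom_eval₂, evalAt, ← MvPolynomial.eval₂_id]
    congr 1
    · ext a
      simp [MonoidAlgebra.singleOneRingHom, evalExpPoly_single]
    · ext ij
      rw [hsu.mul_zpow, Units.val_mul, Matrix.mul_apply]
      simp only [F, map_sum, map_mul, hE, hP, evalExpPoly_single, OneMemClass.coe_one, one_zpow,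
        Units.val_one, mul_one]
  refine isZariskiConnected_of_prime _ fun f g hfg => ?_
  have h0 := eq_zero_of_evalExpPoly _ fun k => (hF k (f * g)).trans (hfg k)
  rw [MvPolynomial.eval₂_mul] at h0
  rcases mul_eq_zero.mp h0 with h | h
  · exact Or.inl fun k => by rw [← hF, h, map_zero]
  · exact Or.inr fun k => by rw [← hF, h, map_zero]

/-! ### Exponentials -/

theorem expGL_val (A : Matrix (Fin n) (Fin n) ℂ) :
    (expGL A : Matrix (Fin n) (Fin n) ℂ) = NormedSpace.exp A := rfl

theorem expGL_add {A B : Matrix (Fin n) (Fin n) ℂ} (h : Commute A B) :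
    expGL (A + B) = expGL A * expGL B :=
  Units.ext (Matrix.exp_add_of_commute A B h)

open scoped Matrix.Norms.Operator in
/-- `ℂ[A]` is finite-dimensional, hence closed, and contains the partial sums of the series. -/
theorem exp_mem_adjoin (A : Matrix (Fin n) (Fin n) ℂ) :
    NormedSpace.exp A ∈ Algebra.adjoin ℂ {A} := by
  refine (Submodule.closed_of_finiteDimensional
    (Subalgebra.toSubmodule (Algebra.adjoin ℂ {A}))).mem_of_tendsto
    (NormedSpace.exp_series_hasSum_exp' (𝕂 := ℂ) A) (Filter.Eventually.of_forall fun F => ?_)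
  exact Submodule.sum_mem _ fun k _ => Submodule.smul_mem _ _
    (pow_mem (Algebra.subset_adjoin (Set.mem_singleton A)) k)

open scoped Matrix.Norms.Operator in
/-- `exp A - 1` lies in the finite-dimensional, hence closed, subspace `A ℂ[A]`. -/
theorem isNilpotent_exp_sub_one {A : Matrix (Fin n) (Fin n) ℂ} (hA : IsNilpotent A) :
    IsNilpotent (NormedSpace.exp A - 1) := by
  let W := (Subalgebra.toSubmodule (Algebra.adjoin ℂ {A})).map (LinearMap.mulLeft ℂ A)
  have hsum : HasSum (fun k : ℕ => ((k + 1).factorial⁻¹ : ℂ) • A ^ (k + 1))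
      (NormedSpace.exp A - 1) := by
    have h := (hasSum_nat_add_iff' 1).mpr (NormedSpace.exp_series_hasSum_exp' (𝕂 := ℂ) A)
    rw [Finset.sum_range_one, Nat.factorial_zero, Nat.cast_one, inv_one, one_smul, pow_zero] at h
    exact h
  have hmem : NormedSpace.exp A - 1 ∈ W := by
    refine (Submodule.closed_of_finiteDimensional W).mem_of_tendsto hsum
      (Filter.Eventually.of_forall fun F => ?_)
    refine Submodule.sum_mem _ fun k _ => Submodule.smul_mem _ _ ?_
    exact ⟨A ^ k, pow_mem (Algebra.subset_adjoin (Set.mem_singleton A)) k, (pow_succ' A k).symm⟩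
  obtain ⟨x, hx, hxA⟩ := hmem
  rw [← hxA]
  have hc : Commute A x := Algebra.commute_of_mem_adjoin_self hx
  exact hc.isNilpotent_mul_right hA

open scoped Matrix.Norms.Operator in
theorem differentiable_evalAt_expGL (A : Matrix (Fin n) (Fin n) ℂ)
    (p : MvPolynomial (Fin n × Fin n) ℂ) :
    Differentiable ℂ fun t : ℂ => evalAt (expGL (t • A)) p := by
  induction p using MvPolynomial.induction_on with
  | C a => simp [evalAt]
  | add p q hp hq => simpa [evalAt] using hp.fun_add hq
  | mul_X p ij hp =>
    have h : Differentiable ℂ fun t : ℂ => NormedSpace.exp (t • A) ij.1 ij.2 := fun t =>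
      ((Matrix.entryLinearMap ℂ ℂ ij.1 ij.2).toContinuousLinearMap.hasFDerivAt.comp_hasDerivAt t
        (hasDerivAt_exp_smul_const A t)).differentiableAt
    simpa [evalAt, expGL_val] using hp.fun_mul h

theorem IsRegular.differentiable_expGL {T : Subgroup (GL (Fin n) ℂ)} {f : T → ℂ}
    (hf : IsRegular T f) {S : Matrix (Fin n) (Fin n) ℂ} (hS : S ∈ lieAlgebra T) :
    Differentiable ℂ fun t : ℂ => f ⟨expGL (t • S), hS t⟩ := by
  obtain ⟨p, k, hp⟩ := hf
  have h : (fun t : ℂ => f ⟨expGL (t • S), hS t⟩) = fun t : ℂ =>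
      evalAt (expGL (t • S)) p / evalAt (expGL (t • S)) (detPoly n) ^ k := by
    ext t
    rw [hp, evalAt_detPoly]
  rw [h]
  refine (differentiable_evalAt_expGL S p).fun_div
    ((differentiable_evalAt_expGL S (detPoly n)).fun_pow k) fun t => ?_
  rw [evalAt_detPoly]
  exact pow_ne_zero _ (det_coe_ne_zero _)

/-- `t ↦ χ(exp(tS))` solves `f' = c f`, `f(0) = 1`. -/
theorem character_expGL_eq_exp {T : Subgroup (GL (Fin n) ℂ)} {χ : T →* ℂˣ}
    {S : Matrix (Fin n) (Fin n) ℂ} (hS : S ∈ lieAlgebra T) {c : ℂ}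
    (hc : HasDerivAt (fun t : ℂ => (χ ⟨expGL (t • S), hS t⟩ : ℂ)) c 0) (t : ℂ) :
    (χ ⟨expGL (t • S), hS t⟩ : ℂ) = Complex.exp (t * c) := by
  set f : ℂ → ℂ := fun t => (χ ⟨expGL (t • S), hS t⟩ : ℂ) with hf
  have hadd : ∀ a b, f (a + b) = f a * f b := by
    intro a b
    have h : (⟨expGL ((a + b) • S), hS (a + b)⟩ : T) =
        ⟨expGL (a • S), hS a⟩ * ⟨expGL (b • S), hS b⟩ := by
      refine Subtype.ext ?_
      change expGL ((a + b) • S) = expGL (a • S) * expGL (b • S)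
      rw [add_smul, expGL_add (((Commute.refl S).smul_left a).smul_right b)]
    simp only [hf]
    rw [h, map_mul, Units.val_mul]
  have h0 : f 0 = 1 := by
    have h1 : f 0 * f 0 = f 0 := by rw [← hadd, add_zero]
    exact (mul_eq_left₀ (Units.ne_zero _)).mp h1
  have hderiv : ∀ t, HasDerivAt f (f t * c) t := by
    intro t
    have h1 : HasDerivAt (fun x => f t * f (x - t)) (f t * c) t := by
      refine HasDerivAt.const_mul (f t) ?_
      have h2 : HasDerivAt f c (t - t) := by rwa [sub_self]
      exact h2.comp_sub_const t t
    refine h1.congr_of_eventuallyEq (Filter.Eventually.of_forall fun x => ?_)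
    change f x = f t * f (x - t)
    rw [← hadd, add_sub_cancel]
  have hderiv' : ∀ t, HasDerivAt (fun t => f t * Complex.exp (-(t * c))) 0 t := by
    intro t
    have h2 : HasDerivAt (fun t : ℂ => Complex.exp (-(t * c)))
        (Complex.exp (-(t * c)) * -(1 * c)) t := (((hasDerivAt_id t).mul_const c).fun_neg).cexp
    exact ((hderiv t).fun_mul h2).congr_deriv (by ring)
  have h3 := is_const_of_deriv_eq_zero (fun t => (hderiv' t).differentiableAt)
    (fun t => (hderiv' t).deriv) t 0
  simp only [h0, zero_mul, neg_zero, Complex.exp_zero, mul_one] at h3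
  rw [Complex.exp_neg, mul_inv_eq_one₀ (Complex.exp_ne_zero _)] at h3
  exact h3

/-- The values of the characters at `exp(2πi S)` are `exp(2πi c)` for `c ∈ X^*(S)`, and such a value
has finite order iff `c` is rational, and is `1` iff `c` is an integer. -/
theorem isMulTorsionFree_characterValues_expGL_iff {T : Subgroup (GL (Fin n) ℂ)}
    {S : Matrix (Fin n) (Fin n) ℂ} (hS : S ∈ lieAlgebra T) :
    IsMulTorsionFree (characterValues T
        ⟨expGL ((2 * (Real.pi : ℂ) * Complex.I) • S), hS _⟩) ↔
      characterDifferentials T S hS ∩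
        (Set.range (fun q : ℚ => (q : ℂ)) \ Set.range (fun m : ℤ => (m : ℂ))) = ∅ := by
  rw [isMulTorsionFree_iff_not_isOfFinOrder]
  constructor
  · intro h
    rw [Set.eq_empty_iff_forall_notMem]
    rintro _ ⟨⟨χ, hχ, hc⟩, ⟨q, rfl⟩, hq⟩
    have hval := character_expGL_eq_exp hS hc (2 * (Real.pi : ℂ) * Complex.I)
    refine h (a := ⟨_, χ, hχ, rfl⟩) (fun h1 => hq ?_) ?_
    · have h2 : χ ⟨_, hS (2 * (Real.pi : ℂ) * Complex.I)⟩ = 1 := congrArg Subtype.val h1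
      rw [h2, Units.val_one] at hval
      obtain ⟨m, hm⟩ := Complex.exp_eq_one_iff.mp hval.symm
      refine ⟨m, ?_⟩
      rw [mul_comm (m : ℂ)] at hm
      exact (mul_left_cancel₀ Complex.two_pi_I_ne_zero hm).symm
    · rw [isOfFinOrder_iff_pow_eq_one]
      refine ⟨q.den, q.den_pos, Subtype.ext (Units.ext ?_)⟩
      change (χ ⟨_, hS (2 * (Real.pi : ℂ) * Complex.I)⟩ : ℂ) ^ q.den = 1
      rw [hval, ← Complex.exp_nat_mul, Complex.exp_eq_one_iff]
      refine ⟨q.num, ?_⟩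
      have h3 : (q : ℂ) * q.den = q.num := by exact_mod_cast Rat.mul_den_eq_num q
      rw [← h3]
      ring
  · rintro h ⟨_, χ, hχ, rfl⟩ hne hfin
    obtain ⟨m, hm, hpow⟩ := isOfFinOrder_iff_pow_eq_one.mp hfin
    have hc := ((hχ.1.differentiable_expGL hS) 0).hasDerivAt
    set c := deriv (fun t : ℂ => (χ ⟨expGL (t • S), hS t⟩ : ℂ)) 0
    have hval := character_expGL_eq_exp hS hc (2 * (Real.pi : ℂ) * Complex.I)
    have hpow' : (χ ⟨_, hS (2 * (Real.pi : ℂ) * Complex.I)⟩ : ℂ) ^ m = 1 :=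
      congrArg (fun z : characterValues T _ => ((z : ℂˣ) : ℂ)) hpow
    rw [hval, ← Complex.exp_nat_mul, Complex.exp_eq_one_iff] at hpow'
    obtain ⟨j, hj⟩ := hpow'
    have hm0 : (m : ℂ) ≠ 0 := Nat.cast_ne_zero.mpr hm.ne'
    have hcj : ((j / m : ℚ) : ℂ) = c := by
      push_cast
      rw [div_eq_iff hm0]
      refine mul_left_cancel₀ Complex.two_pi_I_ne_zero ?_
      linear_combination -hj
    have hint : c ∈ Set.range (fun m : ℤ => (m : ℂ)) := by
      by_contra hnot
      exact Set.eq_empty_iff_forall_notMem.mp h c ⟨⟨χ, hχ, hc⟩, ⟨_, hcj⟩, hnot⟩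
    obtain ⟨l, hl⟩ := hint
    refine hne (Subtype.ext (Units.ext ?_))
    change (χ ⟨_, hS (2 * (Real.pi : ℂ) * Complex.I)⟩ : ℂ) = 1
    rw [hval, Complex.exp_eq_one_iff]
    exact ⟨l, by rw [← hl]; ring⟩

/-- The multiplicative statement, for any torus containing the semisimple part. -/
theorem isZariskiConnected_closedHull_iff {G T : Subgroup (GL (Fin n) ℂ)} (hG : IsZariskiClosed G)
    (hT : IsTorus T) {g s : GL (Fin n) ℂ} (hg : g ∈ G) (hsg : IsSemisimplePartOf s g)
    (hs : s ∈ T) :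
    IsZariskiConnected (closedHull G g) ↔ IsMulTorsionFree (characterValues T ⟨s, hs⟩) := by
  obtain ⟨u, rfl, hsu, hss, hu⟩ := hsg
  rw [closedHull_eq hG hg]
  exact ⟨isMulTorsionFree_of_isZariskiConnected hsu hss hu hs,
    isZariskiConnected_of_isMulTorsionFree hsu hu hT hs⟩

theorem IsLieSemisimplePartOf.isSemisimplePartOf_expGL {S Y : Matrix (Fin n) (Fin n) ℂ}
    (h : IsLieSemisimplePartOf S Y) (c : ℂ) :
    IsSemisimplePartOf (expGL (c • S)) (expGL (c • Y)) := by
  obtain ⟨N, rfl, hSN, hS, hN⟩ := h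
  have hcomm : Commute (c • S) (c • N) := (hSN.smul_left c).smul_right c
  have hcS : c • S ∈ Algebra.adjoin ℂ {S} :=
    Subalgebra.smul_mem _ (Algebra.subset_adjoin (Set.mem_singleton S)) c
  refine ⟨expGL (c • N), ?_, ?_, (hS.of_mem_adjoin hcS).of_mem_adjoin (exp_mem_adjoin _),
    isNilpotent_exp_sub_one (hN.smul c)⟩
  · rw [smul_add, expGL_add hcomm]
  · rw [smul_add, add_comm, expGL_add hcomm.symm]

end LinAlgGrp

end

theorem propositionp (n : ℕ) (G : Subgroup (Matrix.GeneralLinearGroup (Fin n) ℂ))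
    (hG : LinAlgGrp.IsSimpleAlgebraicGroup G) :
    (∀ g ∈ G, ∀ s : Matrix.GeneralLinearGroup (Fin n) ℂ, LinAlgGrp.IsSemisimplePartOf s g →
      ∀ T : Subgroup (Matrix.GeneralLinearGroup (Fin n) ℂ), LinAlgGrp.IsMaximalTorus G T →
      ∀ hs : s ∈ T,
        (LinAlgGrp.IsZariskiConnected (LinAlgGrp.closedHull G g) ↔
          IsMulTorsionFree (LinAlgGrp.characterValues T ⟨s, hs⟩))) ∧
    (∀ Y ∈ LinAlgGrp.lieAlgebra G,
      ∀ S : Matrix (Fin n) (Fin n) ℂ, LinAlgGrp.IsLieSemisimplePartOf S Y →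
      ∀ T : Subgroup (Matrix.GeneralLinearGroup (Fin n) ℂ), LinAlgGrp.IsMaximalTorus G T →
      ∀ hS : S ∈ LinAlgGrp.lieAlgebra T,
        (LinAlgGrp.IsZariskiConnected
            (LinAlgGrp.closedHull G (LinAlgGrp.expGL ((2 * (Real.pi : ℂ) * Complex.I) • Y))) ↔
          LinAlgGrp.characterDifferentials T S hS ∩
            (Set.range (fun q : ℚ => (q : ℂ)) \ Set.range (fun m : ℤ => (m : ℂ))) = ∅)) := by
  refine ⟨fun g hg s hsg T hT hs =>
    LinAlgGrp.isZariskiConnected_closedHull_iff hG.closed hT.prop.1 hg hsg hs,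
    fun Y hY S hSY T hT hS => ?_⟩
  rw [LinAlgGrp.isZariskiConnected_closedHull_iff hG.closed hT.prop.1 (hY _)
    (hSY.isSemisimplePartOf_expGL _) (hS _)]
  exact LinAlgGrp.isMulTorsionFree_characterValues_expGL_iff hS
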